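/- Let $E$ be a Dedekind complete real vector lattice and let $T$ be an orthomorphism of $E$, that is, an order bounded linear operator $T:E\to E$ with $T(B)\subseteq B$ for every band $B$ of $E$. Let $(x_\alpha)$ be a net in $E$. (1) Suppose that $E$ admits a Hausdorff uo-Lebesgue topology $\widehat\tau_E$, that is, a Hausdorff locally solid linear topology such that every net that is unbounded order convergent to $0$ in $E$ converges to $0$ in $\widehat\tau_E$. If $x_\alpha\to 0$ in $\widehat\tau_E$, then $Tx_\alpha\to 0$ in $\widehat\tau_E$. (2) Let $\tau_E$ be a (not necessarily Hausdorff) locally solid linear topology on $E$, and let $\mathrm{u}_E\tau_E$ be the unbounded topology generated by it, that is, the unique locally solid linear topology on $E$ such that a net $(y_\beta)$ in $E$ satisfies $y_\beta\to 0$ in $\mathrm{u}_E\tau_E$ if and only if $|y_\beta|\wedge|s|\to 0$ in $\tau_E$ for all $s\in E$. If $x_\alpha\to 0$ in $\tau_E$, then $Tx_\alpha\to 0$ in $\mathrm{u}_E\tau_E$. Here a net $(y_\beta)_{\beta}$ in $E$ is unbounded order convergent to $0$ if for every $y\in E$ with $y\ge 0$ there is a net $(z_\gamma)_\gamma$ in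 $E$ with $z_\gamma\downarrow 0$ such that for every $\gamma_0$ there exists $\beta_0$ with $|y_\beta|\wedge y\le z_{\gamma_0}$ for all $\beta\ge\beta_0$. -/

import Mathlib

open Filter Set

universe u v

/-- A set which is a band of the vector lattice `E`: a solid linear subspace (an ideal) that
contains every supremum, existing in `E`, of a subset of it. -/
structure IsBand {E : Type u} [AddCommGroup E] [Lattice E] [Module ℝ E]
    (B : Submodule ℝ E) : Prop where
  solid : LatticeOrderedAddCommGroup.IsSolid (B : Set E)
  sup_mem : ∀ (D : Set E) (x : E), D ⊆ B → IsLUB D x → x ∈ B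

/-- `T` maps order bounded sets to order bounded sets. -/
def IsOrderBoundedOperator {E : Type u} [AddCommGroup E] [Lattice E] [Module ℝ E]
    (T : E →ₗ[ℝ] E) : Prop :=
  ∀ s : Set E, BddBelow s → BddAbove s → BddBelow (T '' s) ∧ BddAbove (T '' s)

/-- An orthomorphism of `E`: an order bounded operator that preserves every band. -/
structure IsOrthomorphism {E : Type u} [AddCommGroup E] [Lattice E] [Module ℝ E]
    (T : E →ₗ[ℝ] E) : Prop where
  orderBounded : IsOrderBoundedOperator T
  bandPreserving : ∀ B : Submodule ℝ E, IsBand B → ∀ x ∈ B, T x ∈ B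

/-- Order convergence of the net `x` to `a`: for some net `y` with `y ↓ 0`, indexed by a directed
set that need not be that of `x`, each `y b` eventually dominates `|a - x i|`. (Since the range of
`y`, reversed, can serve as index set, one universe of index sets `B` is enough.) -/
def OrderConverges {E : Type u} [AddCommGroup E] [Lattice E] {ι : Type v} [Preorder ι]
    (x : ι → E) (a : E) : Prop :=
  ∃ (B : Type u) (_ : Preorder B) (_ : IsDirectedOrder B) (_ : Nonempty B) (y : B → E),
    Antitone y ∧ IsGLB (range y) 0 ∧ ∀ b : B, ∃ i₀ : ι, ∀ i ≥ i₀, |a - x i| ≤ y b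

/-- Unbounded order convergence of the net `x` to `a`. -/
def UnboundedOrderConverges {E : Type u} [AddCommGroup E] [Lattice E] {ι : Type v} [Preorder ι]
    (x : ι → E) (a : E) : Prop :=
  ∀ y : E, 0 ≤ y → OrderConverges (fun i => |x i - a| ⊓ y) 0

/-- A (not necessarily Hausdorff) locally solid linear topology on `E`. -/
structure IsLocallySolidLinearTopology {E : Type u} [AddCommGroup E] [Lattice E] [Module ℝ E]
    (τ : TopologicalSpace E) : Prop where
  topologicalAddGroup : @IsTopologicalAddGroup E τ _
  continuousSMul : @ContinuousSMul ℝ E _ _ τ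
  exists_solid : ∀ U ∈ @nhds E τ 0, ∃ V ∈ @nhds E τ 0,
    LatticeOrderedAddCommGroup.IsSolid V ∧ V ⊆ U

/-- A (not necessarily Hausdorff) uo-Lebesgue topology on `E`: a locally solid linear topology
for which uo-null nets are null nets. (A net with a larger index set has the same tails as a net
indexed by pairs of a tail set and a point of it, so one universe is enough.) -/
structure IsUoLebesgueTopology {E : Type u} [AddCommGroup E] [Lattice E] [Module ℝ E]
    (τ : TopologicalSpace E) : Prop where
  locallySolid : IsLocallySolidLinearTopology τ
  tendsto_of_uo : ∀ (ι : Type u) [Preorder ι] [IsDirectedOrder ι] [Nonempty ι] (x : ι → E),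
    UnboundedOrderConverges x 0 → Tendsto x atTop (@nhds E τ 0)

/-- The filter of neighbourhoods of `a` in the unbounded topology: it is generated by the sets
`{x | |x - a| ⊓ |s| ∈ V}`, for `s` in `E` and `V` a `τ`-neighbourhood of `0`. -/
def unboundedNhds {E : Type u} [AddCommGroup E] [Lattice E] (τ : TopologicalSpace E) (a : E) :
    Filter E :=
  ⨅ s : E, comap (fun x => |x - a| ⊓ |s|) (@nhds E τ 0)

/-- The unbounded topology on `E` that is generated by `τ` (via the whole of `E`). That it is the
unique locally solid linear topology with the prescribed null nets is proved below. -/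
@[reducible] def unboundedTopology {E : Type u} [AddCommGroup E] [Lattice E] (τ : TopologicalSpace E) :
    TopologicalSpace E :=
  TopologicalSpace.mkOfNhds (unboundedNhds τ)

theorem abs_add_inf_le {E : Type u} [AddCommGroup E] [Lattice E] [IsOrderedAddMonoid E]
    (x y s : E) : |x + y| ⊓ |s| ≤ |x| ⊓ |s| + |y| ⊓ |s| := by
  have hy : 0 ≤ |y| ⊓ |s| := le_inf (abs_nonneg _) (abs_nonneg _)
  have h1 : |x + y| ⊓ |s| ≤ (|x| + |y|) ⊓ |s| := inf_le_inf_right _ (abs_add_le x y)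
  refine h1.trans (sub_le_iff_le_add.mp (le_inf ?_ ?_))
  · have h := abs_inf_sub_inf_le_abs (|x| + |y|) |y| |s|
    rw [add_sub_cancel_right, abs_abs] at h
    exact (le_abs_self _).trans h
  · exact (sub_le_self _ hy).trans inf_le_right

theorem abs_smul_le_smul_abs {E : Type u} [AddCommGroup E] [Lattice E] [Module ℝ E]
    [IsOrderedModule ℝ E] (r : ℝ) (x : E) : |r • x| ≤ |r| • |x| := by
  have key : ∀ (c : ℝ), 0 ≤ c → |c • x| ≤ c • |x| := fun c hc => by
    refine abs_le'.mpr ⟨smul_le_smul_of_nonneg_left (le_abs_self x) hc, ?_⟩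
    rw [← smul_neg]
    exact smul_le_smul_of_nonneg_left (neg_le_abs x) hc
  rcases le_total 0 r with h | h
  · rw [abs_of_nonneg h]; exact key r h
  · rw [abs_of_nonpos h, ← abs_neg (r • x), ← neg_smul]; exact key (-r) (neg_nonneg.mpr h)

theorem IsLocallySolidLinearTopology.squeeze {E : Type u} [AddCommGroup E] [Lattice E] [Module ℝ E]
    {τ : TopologicalSpace E} (hτ : IsLocallySolidLinearTopology τ)
    {ι : Type v} {l : Filter ι} {f g : ι → E} (hfg : ∀ᶠ i in l, |f i| ≤ |g i|)
    (hg : Tendsto g l (@nhds E τ 0)) : Tendsto f l (@nhds E τ 0) := by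
  intro U hU
  obtain ⟨V, hV, hVs, hVU⟩ := hτ.exists_solid U hU
  have hgV : ∀ᶠ i in l, g i ∈ V := hg hV
  show ∀ᶠ i in l, f i ∈ U
  filter_upwards [hfg, hgV] with i hi hgi
  exact hVU (hVs hgi hi)

theorem tendsto_unboundedNhds {E : Type u} [AddCommGroup E] [Lattice E] {τ : TopologicalSpace E}
    {ι : Type v} {l : Filter ι} {f : ι → E} {a : E} :
    Tendsto f l (unboundedNhds τ a) ↔
      ∀ s : E, Tendsto (fun i => |f i - a| ⊓ |s|) l (@nhds E τ 0) := by
  simp only [unboundedNhds, tendsto_iInf, tendsto_comap_iff]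
  rfl

section Unbounded

variable {E : Type u} [AddCommGroup E] [Lattice E] [IsOrderedAddMonoid E] [Module ℝ E]
  {τ : TopologicalSpace E}

theorem mem_unboundedNhds (hτ : IsLocallySolidLinearTopology τ) {a : E} {U : Set E} :
    U ∈ unboundedNhds τ a ↔ ∃ s : E, ∃ V ∈ @nhds E τ 0,
      LatticeOrderedAddCommGroup.IsSolid V ∧ {x | |x - a| ⊓ |s| ∈ V} ⊆ U := by
  have hdir : Directed (· ≥ ·) fun s : E => comap (fun x => |x - a| ⊓ |s|) (@nhds E τ 0) := by
    have aux : ∀ s t : E, |s| ≤ |t| → comap (fun x => |x - a| ⊓ |t|) (@nhds E τ 0) ≤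
        comap (fun x => |x - a| ⊓ |s|) (@nhds E τ 0) := fun s t hst => by
      refine tendsto_iff_comap.mp (hτ.squeeze (.of_forall fun x => ?_) tendsto_comap)
      rw [abs_of_nonneg (le_inf (abs_nonneg _) (abs_nonneg _)),
        abs_of_nonneg (le_inf (abs_nonneg _) (abs_nonneg _))]
      exact inf_le_inf_left _ hst
    intro s t
    have h : |(|s| ⊔ |t|)| = |s| ⊔ |t| := abs_of_nonneg ((abs_nonneg s).trans le_sup_left)
    exact ⟨|s| ⊔ |t|, aux _ _ (le_sup_left.trans h.ge), aux _ _ (le_sup_right.trans h.ge)⟩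
  rw [unboundedNhds, mem_iInf_of_directed hdir]
  refine exists_congr fun s => ⟨fun h => ?_, fun ⟨V, hV, _, hVU⟩ => ⟨V, hV, hVU⟩⟩
  obtain ⟨W, hW, hWU⟩ := h
  obtain ⟨V, hV, hVs, hVW⟩ := hτ.exists_solid W hW
  exact ⟨V, hV, hVs, fun x hx => hWU (hVW hx)⟩

theorem nhds_unboundedTopology (hτ : IsLocallySolidLinearTopology τ) (a : E) :
    @nhds E (unboundedTopology τ) a = unboundedNhds τ a := by
  have := hτ.topologicalAddGroup
  refine TopologicalSpace.nhds_mkOfNhds _ a (fun b => ?_) (fun b U hU => ?_)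
  · have hid : Tendsto id (pure b) (unboundedNhds τ b) := by
      refine tendsto_unboundedNhds.mpr fun s => ?_
      rw [tendsto_pure_left]
      intro V hV
      simpa using mem_of_mem_nhds hV
    exact hid
  · obtain ⟨s, V, hV, hVs, hVU⟩ := (mem_unboundedNhds hτ).mp hU
    have hadd : Tendsto (fun p : E × E => p.1 + p.2) (nhds 0 ×ˢ nhds 0) (nhds 0) := by
      simpa [nhds_prod_eq] using (continuous_add (M := E)).tendsto (0, 0)
    obtain ⟨W₁, hW₁, W₂, hW₂, hW⟩ := mem_prod_iff.mp (hadd hV)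
    obtain ⟨W, hWn, hWs, hWW⟩ := hτ.exists_solid _ (inter_mem hW₁ hW₂)
    refine (mem_unboundedNhds hτ).mpr ⟨s, W, hWn, hWs, fun y hy => ?_⟩
    refine (mem_unboundedNhds hτ).mpr ⟨s, W, hWn, hWs, fun x hx => hVU ?_⟩
    have h := abs_add_inf_le (x - y) (y - b) s
    rw [sub_add_sub_cancel] at h
    have hm : |x - y| ⊓ |s| + |y - b| ⊓ |s| ∈ V :=
      hW (show (|x - y| ⊓ |s|, |y - b| ⊓ |s|) ∈ W₁ ×ˢ W₂ from ⟨(hWW hx).1, (hWW hy).2⟩)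
    refine hVs hm (abs_le_abs_of_nonneg (le_inf (abs_nonneg _) (abs_nonneg _)) h)

/-- The defining property of the unbounded topology: `f → 0` if and only if
`|f| ⊓ |s| → 0` for `τ`, for all `s`. -/
theorem tendsto_unboundedTopology_zero (hτ : IsLocallySolidLinearTopology τ)
    {ι : Type v} {l : Filter ι} {f : ι → E} :
    Tendsto f l (@nhds E (unboundedTopology τ) 0) ↔
      ∀ s : E, Tendsto (fun i => |f i| ⊓ |s|) l (@nhds E τ 0) := by
  rw [nhds_unboundedTopology hτ, tendsto_unboundedNhds]
  simp

variable [IsOrderedModule ℝ E]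

theorem isLocallySolidLinearTopology_unboundedTopology (hτ : IsLocallySolidLinearTopology τ) :
    IsLocallySolidLinearTopology (unboundedTopology τ) := by
  have h0 := fun (ι : Type u) (l : Filter ι) (f : ι → E) =>
    tendsto_unboundedTopology_zero (l := l) (f := f) hτ
  have hnn : ∀ x s : E, |(|x| ⊓ |s|)| = |x| ⊓ |s| := fun x s =>
    abs_of_nonneg (le_inf (abs_nonneg _) (abs_nonneg _))
  have hid : ∀ s : E, Tendsto (fun x : E => |x| ⊓ |s|) (@nhds E (unboundedTopology τ) 0)
      (@nhds E τ 0) := (h0 E _ _).mp tendsto_id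
  have hgrp : @IsTopologicalAddGroup E (unboundedTopology τ) _ := by
    let _ := unboundedTopology τ
    refine IsTopologicalAddGroup.of_comm_of_nhds_zero (G := E) ?_ ?_ fun a => ?_
    · refine (h0 _ _ _).mpr fun s => ?_
      have hadd : Tendsto (fun p : E × E => p.1 + p.2) (@nhds E τ 0 ×ˢ @nhds E τ 0)
          (@nhds E τ 0) := by
        let _ := τ
        have := hτ.topologicalAddGroup
        simpa [nhds_prod_eq] using (continuous_add (M := E)).tendsto (0, 0)
      refine hτ.squeeze (.of_forall fun p => ?_)
        (hadd.comp (((hid s).comp tendsto_fst).prodMk ((hid s).comp tendsto_snd)))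
      exact abs_le_abs_of_nonneg (le_inf (abs_nonneg _) (abs_nonneg _))
        (abs_add_inf_le p.1 p.2 s)
    · refine (h0 _ _ _).mpr fun s => ?_
      simpa using hid s
    · refine le_antisymm ?_ ?_
      · have hm : map (fun x => a + x) (map (fun x => x - a) (nhds a)) = nhds a := by
          simp [Filter.map_map, Function.comp_def]
        rw [← hm]
        refine map_mono ?_
        refine (h0 _ _ _).mpr ?_
        rw [nhds_unboundedTopology hτ]
        exact tendsto_unboundedNhds.mp tendsto_id
      · rw [nhds_unboundedTopology hτ a]
        refine tendsto_unboundedNhds.mpr fun s => ?_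
        simpa using hid s
  refine ⟨hgrp, ?_, fun U hU => ?_⟩
  · let _ := unboundedTopology τ
    have hτs : ∀ a : ℝ, Tendsto (fun x : E => a • x) (@nhds E τ 0) (@nhds E τ 0) := fun a => by
      let _ := τ
      have := hτ.continuousSMul
      simpa using (continuous_const_smul (T := E) a).tendsto 0
    have hτm : ∀ m : E, Tendsto (fun a : ℝ => a • m) (nhds 0) (@nhds E τ 0) := fun m => by
      let _ := τ
      have := hτ.continuousSMul
      have hc : Continuous fun a : ℝ => a • m := continuous_id.smul continuous_const
      simpa using hc.tendsto 0
    refine ContinuousSMul.of_nhds_zero ?_ (fun m => ?_) (fun a => ?_)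
    · refine (tendsto_unboundedTopology_zero hτ).mpr fun s => ?_
      refine hτ.squeeze ?_ ((hid s).comp tendsto_snd)
      have hsmall : ∀ᶠ r : ℝ in nhds 0, |r| ≤ 1 := by
        filter_upwards [Metric.closedBall_mem_nhds (0 : ℝ) one_pos] with r hr
        simpa using hr
      filter_upwards [tendsto_fst.eventually hsmall] with p hp
      simp only [Function.comp, hnn]
      refine inf_le_inf_right _ ((abs_smul_le_smul_abs p.1 p.2).trans ?_)
      simpa using smul_le_smul_of_nonneg_right hp (abs_nonneg p.2)
    · refine (tendsto_unboundedTopology_zero hτ).mpr fun s => ?_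
      refine hτ.squeeze (.of_forall fun r => ?_) (hτm m)
      rw [hnn]
      exact inf_le_left
    · refine (tendsto_unboundedTopology_zero hτ).mpr fun s => ?_
      have hK : 0 < max 1 |a| := lt_max_of_lt_left one_pos
      refine hτ.squeeze (.of_forall fun x => ?_) ((hτs (max 1 |a|)).comp (hid s))
      rw [hnn]
      refine le_trans ?_ (le_abs_self _)
      rw [Function.comp, ← inv_smul_le_iff_of_pos hK]
      refine le_inf ?_ ?_
      · rw [inv_smul_le_iff_of_pos hK]
        exact inf_le_left.trans ((abs_smul_le_smul_abs a x).trans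
          (smul_le_smul_of_nonneg_right (le_max_right _ _) (abs_nonneg x)))
      · rw [inv_smul_le_iff_of_pos hK]
        refine inf_le_right.trans ?_
        simpa using smul_le_smul_of_nonneg_right (le_max_left 1 |a|) (abs_nonneg s)
  · rw [nhds_unboundedTopology hτ] at hU
    obtain ⟨s, V, hV, hVs, hVU⟩ := (mem_unboundedNhds hτ).mp hU
    refine ⟨{x | |x - 0| ⊓ |s| ∈ V}, ?_, fun x hx y hxy => ?_, hVU⟩
    · rw [nhds_unboundedTopology hτ]
      exact (mem_unboundedNhds hτ).mpr ⟨s, V, hV, hVs, Subset.rfl⟩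
    · simp only [mem_ofPred_eq, sub_zero] at hx ⊢
      refine hVs hx ?_
      rw [hnn, hnn]
      exact inf_le_inf_right _ hxy

/-- The unbounded topology is the only locally solid linear topology with its null nets. -/
theorem eq_unboundedTopology (hτ : IsLocallySolidLinearTopology τ) {σ : TopologicalSpace E}
    (hσ : IsLocallySolidLinearTopology σ)
    (h : ∀ (ι : Type u) [Preorder ι] [IsDirectedOrder ι] [Nonempty ι] (x : ι → E),
      Tendsto x atTop (@nhds E σ 0) ↔
        ∀ s : E, Tendsto (fun i => |x i| ⊓ |s|) atTop (@nhds E τ 0)) :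
    σ = unboundedTopology τ := by
  have hu := isLocallySolidLinearTopology_unboundedTopology hτ
  refine IsTopologicalAddGroup.ext hσ.topologicalAddGroup hu.topologicalAddGroup ?_
  have hnet : ∀ F G : Filter E,
      (∀ (ι : Type u) [Preorder ι] [IsDirectedOrder ι] [Nonempty ι] (x : ι → E),
        Tendsto x atTop F → Tendsto x atTop G) → F ≤ G := by
    intro F G hFG U hU
    by_contra hUF
    have hne : ∀ A : {A : Set E // A ∈ F}, ∃ x ∈ A.1, x ∉ U := fun A => by
      by_contra! hA
      exact hUF (mem_of_superset A.2 hA)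
    choose x hxA hxU using hne
    let y : {A : Set E // A ∈ F}ᵒᵈ → E := fun A => x (OrderDual.ofDual A)
    have hdir : IsDirectedOrder {A : Set E // A ∈ F}ᵒᵈ :=
      ⟨fun A B => ⟨OrderDual.toDual ⟨_, inter_mem (OrderDual.ofDual A).2 (OrderDual.ofDual B).2⟩,
        fun _ hz => hz.1, fun _ hz => hz.2⟩⟩
    have hnon : Nonempty {A : Set E // A ∈ F}ᵒᵈ := ⟨OrderDual.toDual ⟨univ, univ_mem⟩⟩
    have hy : Tendsto y atTop F := fun A hA => by
      refine mem_map.mpr (mem_atTop_sets.mpr ⟨OrderDual.toDual ⟨A, hA⟩, fun B hB => ?_⟩)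
      exact hB (hxA (OrderDual.ofDual B))
    obtain ⟨A, hA⟩ := (hFG _ y hy hU |> mem_map.mp |> mem_atTop_sets.mp)
    exact hxU _ (hA A le_rfl)
  refine le_antisymm (hnet _ _ fun ι _ _ _ x hx => ?_) (hnet _ _ fun ι _ _ _ x hx => ?_)
  · exact (tendsto_unboundedTopology_zero hτ).mpr ((h ι x).mp hx)
  · exact (h ι x).mpr ((tendsto_unboundedTopology_zero hτ).mp hx)

end Unbounded

/-! Were `T` multiplication by a function `m`, then wherever `|T x|` exceeds `c • |x|` one would
have `|m| > c`, hence `s ≤ c⁻¹ • |T s|` for `s ≥ 0`. So `(|T x| - c • |x|)⁺ ⊓ s` is at most a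
multiple of `c⁻¹ • |T s|`, uniformly in `x`. This is `posPart_inf_le`; it is proved without a
representation theorem, by comparing elements on small bands (`LocLE`). The estimate makes `|T x|`
at most `c • |x|` plus an error that tends to zero as `c` grows: in the uo sense by itself, and in
every linear topology after an infimum with `s`. A uo-Lebesgue topology makes the first error small
(`exists_posPart_mem`), which gives (1); the second gives (2). In both cases
`tendsto_zero_of_abs_le` concludes. -/

theorem posPart_smul_le {E : Type u} [AddCommGroup E] [Lattice E] [Module ℝ E]
    [IsOrderedModule ℝ E] {c : ℝ} (hc : 0 ≤ c) (a : E) : (c • a)⁺ ≤ c • a⁺ :=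
  sup_le (smul_le_smul_of_nonneg_left (le_posPart a) hc) (smul_nonneg hc (posPart_nonneg a))

/-! ### Inequalities on a band, and how orthomorphisms respect them. -/

section LocalOrder

variable {E : Type u} [AddCommGroup E] [Lattice E]

theorem inf_eq_zero_of_le {a b v w : E} (ha : 0 ≤ a) (hv : 0 ≤ v) (hab : a ≤ b)
    (hvw : v ≤ w) (h : b ⊓ w = 0) : a ⊓ v = 0 :=
  le_antisymm (h ▸ inf_le_inf hab hvw) (le_inf ha hv)

/-- `a ≤ b` on the band generated by the positive element `v`. -/
def LocLE (v a b : E) : Prop := (a - b)⁺ ⊓ v = 0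

theorem LocLE.mono {v w a b : E} (hv : 0 ≤ v) (hvw : v ≤ w) (h : LocLE w a b) : LocLE v a b :=
  inf_eq_zero_of_le (posPart_nonneg _) hv le_rfl hvw h

theorem LocLE.of_sub_le {v a b a' b' : E} (hv : 0 ≤ v) (h : LocLE v a b)
    (hab : a' - b' ≤ a - b) : LocLE v a' b' :=
  inf_eq_zero_of_le (posPart_nonneg _) hv (posPart_mono hab) le_rfl h

variable [IsOrderedAddMonoid E]

theorem posPart_inf_posPart_neg_eq_zero (a : E) : a⁺ ⊓ (-a)⁺ = 0 := by
  rw [posPart_neg]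
  exact posPart_inf_negPart_eq_zero a

theorem add_inf_eq_zero {a b v : E} (ha : 0 ≤ a) (hb : 0 ≤ b) (hv : 0 ≤ v)
    (hav : a ⊓ v = 0) (hbv : b ⊓ v = 0) : (a + b) ⊓ v = 0 := by
  have h := abs_add_inf_le a b v
  rw [abs_of_nonneg ha, abs_of_nonneg hb, abs_of_nonneg hv, abs_of_nonneg (add_nonneg ha hb),
    hav, hbv, add_zero] at h
  exact le_antisymm h (le_inf (add_nonneg ha hb) hv)

theorem add_posPart_le (a b : E) : (a + b)⁺ ≤ a⁺ + b⁺ :=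
  sup_le (add_le_add (le_posPart a) (le_posPart b))
    (add_nonneg (posPart_nonneg a) (posPart_nonneg b))

theorem le_add_posPart_sub (a b : E) : a ≤ b + (a - b)⁺ :=
  sub_le_iff_le_add'.mp (le_posPart _)

theorem LocLE.of_le {v a b : E} (hv : 0 ≤ v) (h : a ≤ b) : LocLE v a b := by
  rw [LocLE, posPart_eq_zero.mpr (sub_nonpos.mpr h)]
  exact inf_eq_left.mpr hv

theorem LocLE.add {v a b a' b' : E} (hv : 0 ≤ v) (h : LocLE v a b) (h' : LocLE v a' b') :
    LocLE v (a + a') (b + b') := by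
  refine inf_eq_zero_of_le (posPart_nonneg _) hv ?_ le_rfl
    (add_inf_eq_zero (posPart_nonneg _) (posPart_nonneg _) hv h h')
  rw [add_sub_add_comm]
  exact add_posPart_le _ _

theorem LocLE.trans {v a b c : E} (hv : 0 ≤ v) (h : LocLE v a b) (h' : LocLE v b c) :
    LocLE v a c :=
  (h.add hv h').of_sub_le hv (by rw [add_sub_add_comm]; exact (by abel : a - c = _).le)

variable [Module ℝ E]

/-- The constant `c` may depend on `V` but not on the index, so `c • |x i|` still tends to zero. -/
theorem IsLocallySolidLinearTopology.tendsto_zero_of_abs_le {τ : TopologicalSpace E}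
    (hτ : IsLocallySolidLinearTopology τ) {ι : Type v} {l : Filter ι} {x f : ι → E}
    (hx : Tendsto x l (@nhds E τ 0))
    (h : ∀ V ∈ @nhds E τ 0, ∃ (c : ℝ) (b : ι → E), (∀ i, b i ∈ V) ∧
      ∀ i, |f i| ≤ c • |x i| + b i) : Tendsto f l (@nhds E τ 0) := by
  have := hτ.topologicalAddGroup
  have := hτ.continuousSMul
  have hax : Tendsto (fun i => |x i|) l (nhds 0) := hτ.squeeze (.of_forall fun i => by simp) hx
  intro U hU
  obtain ⟨W, hW, hWs, hWU⟩ := hτ.exists_solid U hU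
  have hadd : Tendsto (fun p : E × E => p.1 + p.2) (nhds 0 ×ˢ nhds 0) (nhds 0) := by
    simpa [nhds_prod_eq] using (continuous_add (M := E)).tendsto (0, 0)
  obtain ⟨V₁, hV₁, V₂, hV₂, hV⟩ := mem_prod_iff.mp (hadd hW)
  obtain ⟨c, b, hb, hf⟩ := h V₂ hV₂
  have hcx : Tendsto (fun i => c • |x i|) l (nhds 0) := by simpa using hax.const_smul c
  show ∀ᶠ i in l, f i ∈ U
  filter_upwards [hcx hV₁] with i hi
  have hm : c • |x i| + b i ∈ W := hV (show (c • |x i|, b i) ∈ V₁ ×ˢ V₂ from ⟨hi, hb i⟩)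
  exact hWU (hWs hm ((hf i).trans (le_abs_self _)))

variable [IsOrderedModule ℝ E]

theorem smul_inf_eq_zero {a v : E} (ha : 0 ≤ a) (hv : 0 ≤ v) {c : ℝ} (hc : 0 ≤ c)
    (h : a ⊓ v = 0) : (c • a) ⊓ v = 0 := by
  -- Division by `max 1 c` brings `c • a` below `a` and keeps `v` below `v`.
  have hd : 0 < max 1 c := lt_max_of_lt_left one_pos
  refine le_antisymm ?_ (le_inf (smul_nonneg hc ha) hv)
  have key : (max 1 c)⁻¹ • ((c • a) ⊓ v) ≤ a ⊓ v := by
    refine le_inf ?_ ?_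
    · rw [inv_smul_le_iff_of_pos hd]
      exact inf_le_left.trans (smul_le_smul_of_nonneg_right (le_max_right _ _) ha)
    · rw [inv_smul_le_iff_of_pos hd]
      refine inf_le_right.trans ?_
      simpa using smul_le_smul_of_nonneg_right (le_max_left 1 c) hv
  rw [h, inv_smul_le_iff_of_pos hd, smul_zero] at key
  exact key

theorem LocLE.smul {v a b : E} (hv : 0 ≤ v) {c : ℝ} (hc : 0 ≤ c) (h : LocLE v a b) :
    LocLE v (c • a) (c • b) := by
  refine inf_eq_zero_of_le (posPart_nonneg _) hv ?_ le_rfl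
    (smul_inf_eq_zero (posPart_nonneg _) hv hc h)
  rw [← smul_sub]
  exact posPart_smul_le hc _

/-- The disjoint complement of a positive element. -/
def disjointComplement (v : E) (hv : 0 ≤ v) : Submodule ℝ E where
  carrier := {a | |a| ⊓ v = 0}
  zero_mem' := by simpa using hv
  add_mem' {a b} ha hb := inf_eq_zero_of_le (abs_nonneg _) hv (abs_add_le a b) le_rfl
    (add_inf_eq_zero (abs_nonneg _) (abs_nonneg _) hv ha hb)
  smul_mem' c a ha := inf_eq_zero_of_le (abs_nonneg _) hv (abs_smul_le_smul_abs c a) le_rfl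
    (smul_inf_eq_zero (abs_nonneg _) hv (abs_nonneg c) ha)

/-- For suprema: `x⁺ ⊓ v` is disjoint from each `d⁺` with `d` in `D`, so `x⁺ - x⁺ ⊓ v` is still an
upper bound of `D`. The negative part of `x` is below `|d₀|` for any `d₀` in `D`. -/
theorem isBand_disjointComplement (v : E) (hv : 0 ≤ v) : IsBand (disjointComplement v hv) where
  solid a ha b hab := inf_eq_zero_of_le (abs_nonneg _) hv hab le_rfl ha
  sup_mem D x hD hx := by
    rcases D.eq_empty_or_nonempty with rfl | ⟨d₀, hd₀⟩
    -- A supremum of the empty set is a least element, which must be zero.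
    · have hmin : ∀ y, x ≤ y := fun y => hx.2 (by simp)
      have h0 : x = 0 := le_antisymm (hmin 0) (by simpa using hmin (x + x))
      exact h0 ▸ Submodule.zero_mem _
    have hpos : x⁺ ⊓ v = 0 := by
      have hz : x ≤ x⁺ - x⁺ ⊓ v := by
        refine hx.2 fun d hd => ?_
        have hdv : d⁺ ⊓ (x⁺ ⊓ v) = 0 := by
          refine inf_eq_zero_of_le (posPart_nonneg _) (le_inf (posPart_nonneg _) hv) ?_
            inf_le_right (hD hd)
          exact sup_le (le_abs_self d) (abs_nonneg d)
        have hsum : d⁺ + x⁺ ⊓ v ≤ x⁺ := by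
          rw [← inf_add_sup, hdv, zero_add]
          exact sup_le (posPart_mono (hx.1 hd)) inf_le_left
        exact (le_posPart d).trans (le_sub_iff_add_le.mpr hsum)
      have h : x⁺ ≤ x⁺ - x⁺ ⊓ v := sup_le hz (sub_nonneg.mpr inf_le_left)
      exact le_antisymm ((add_le_iff_nonpos_right _).mp (le_sub_iff_add_le.mp h))
        (le_inf (posPart_nonneg _) hv)
    have hneg : x⁻ ⊓ v = 0 := by
      refine inf_eq_zero_of_le (negPart_nonneg _) hv ?_ le_rfl (hD hd₀)
      exact sup_le ((neg_le_neg (hx.1 hd₀)).trans (neg_le_abs d₀)) (abs_nonneg d₀)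
    show |x| ⊓ v = 0
    rw [← posPart_add_negPart]
    exact add_inf_eq_zero (posPart_nonneg _) (negPart_nonneg _) hv hpos hneg

theorem IsOrthomorphism.abs_inf_eq_zero {T : E →ₗ[ℝ] E} (hT : IsOrthomorphism T) {a v : E}
    (hv : 0 ≤ v) (h : |a| ⊓ v = 0) : |T a| ⊓ v = 0 :=
  hT.bandPreserving _ (isBand_disjointComplement v hv) a h

/-- By homogeneity one bound on the image of `[0, s]` serves every scale, so `ε` can be chosen after
`M`. -/
theorem IsOrderBoundedOperator.exists_bound {T : E →ₗ[ℝ] E} (hT : IsOrderBoundedOperator T)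
    (s : E) : ∃ M : E, 0 ≤ M ∧ ∀ ε : ℝ, 0 < ε → ∀ r : E, 0 ≤ r → r ≤ ε • s → |T r| ≤ ε • M := by
  obtain ⟨⟨l, hl⟩, u, hu⟩ := hT (Icc 0 s) bddBelow_Icc bddAbove_Icc
  refine ⟨|l| ⊔ |u|, (abs_nonneg l).trans le_sup_left, fun ε hε r hr hrs => ?_⟩
  have hmem : T (ε⁻¹ • r) ∈ T '' Icc 0 s :=
    mem_image_of_mem T ⟨smul_nonneg (inv_nonneg.mpr hε.le) hr,
      (inv_smul_le_iff_of_pos hε).mpr hrs⟩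
  have hb : |T (ε⁻¹ • r)| ≤ |l| ⊔ |u| :=
    abs_le'.mpr ⟨(hu hmem).trans ((le_abs_self u).trans le_sup_right),
      (neg_le_neg (hl hmem)).trans ((neg_le_abs l).trans le_sup_left)⟩
  have he : T r = ε • T (ε⁻¹ • r) := by rw [← map_smul, smul_inv_smul₀ hε.ne']
  rw [he]
  refine (abs_smul_le_smul_abs _ _).trans ?_
  rw [abs_of_pos hε]
  exact smul_le_smul_of_nonneg_left hb hε.le

/-- An orthomorphism maps an element that lies between `0` and `ε • s` on the band of `v` to one
dominated by `ε • M` there. -/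
theorem IsOrthomorphism.locLE_abs {T : E →ₗ[ℝ] E} (hT : IsOrthomorphism T) {v r s M : E} {ε : ℝ}
    (hv : 0 ≤ v) (hs : 0 ≤ s) (hε : 0 < ε)
    (hM : ∀ r : E, 0 ≤ r → r ≤ ε • s → |T r| ≤ ε • M)
    (h0 : LocLE v 0 r) (h1 : LocLE v r (ε • s)) : LocLE v |T r| (ε • M) := by
  have hεs : 0 ≤ ε • s := smul_nonneg hε.le hs
  -- The truncation of `r` to `[0, ε • s]` differs from `r` only by an element disjoint from `v`,
  -- and so do their images under `T`.
  set r' := (r ⊔ 0) ⊓ (ε • s) with hr'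
  have hd : |r - r'| ≤ (0 - r)⁺ + (r - ε • s)⁺ := by
    have h2 : r' ≤ r + (0 - r)⁺ := by
      refine inf_le_left.trans (sup_le ?_ ?_)
      · exact le_add_of_nonneg_right (posPart_nonneg _)
      · exact sub_le_iff_le_add'.mp (le_posPart _)
    have h3 : r ≤ r' + (r - ε • s)⁺ := by
      rw [← sub_le_iff_le_add]
      refine le_inf ?_ ?_
      · exact (sub_le_self _ (posPart_nonneg _)).trans le_sup_left
      · rw [sub_le_iff_le_add]
        exact sub_le_iff_le_add'.mp (le_posPart _)
    refine abs_le'.mpr ⟨?_, ?_⟩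
    · exact (sub_le_iff_le_add'.mpr h3).trans (le_add_of_nonneg_left (posPart_nonneg _))
    · rw [neg_sub]
      exact (sub_le_iff_le_add'.mpr h2).trans (le_add_of_nonneg_right (posPart_nonneg _))
  have hdv : |r - r'| ⊓ v = 0 := inf_eq_zero_of_le (abs_nonneg _) hv hd le_rfl
    (add_inf_eq_zero (posPart_nonneg _) (posPart_nonneg _) hv h0 h1)
  have hTr : LocLE v |T r| |T r'| := by
    refine inf_eq_zero_of_le (posPart_nonneg _) hv ?_ le_rfl (hT.abs_inf_eq_zero hv hdv)
    rw [map_sub]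
    exact sup_le (sub_le_iff_le_add.mpr (by simpa using abs_add_le (T r - T r') (T r')))
      (abs_nonneg _)
  exact hTr.trans hv (.of_le hv (hM r' (le_inf le_sup_right hεs) inf_le_right))

end LocalOrder

/-! ### The Archimedean property and the key estimate. -/

theorem nonpos_of_forall_natCast_smul_le {E : Type u} [AddCommGroup E]
    [ConditionallyCompleteLattice E] [IsOrderedAddMonoid E] [Module ℝ E] {w z : E}
    (h : ∀ k : ℕ, (k : ℝ) • w ≤ z) : w ≤ 0 := by
  have hb : BddAbove (range fun k : ℕ => (k : ℝ) • w) := ⟨z, by rintro _ ⟨k, rfl⟩; exact h k⟩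
  have h1 : (⨆ k : ℕ, (k : ℝ) • w) ≤ (⨆ k : ℕ, (k : ℝ) • w) - w := by
    refine ciSup_le fun k => le_sub_iff_add_le.mpr ?_
    have h2 := le_ciSup hb (k + 1)
    simpa [add_smul] using h2
  simpa using le_sub_iff_add_le.mp h1

section DedekindComplete

variable {E : Type u} [AddCommGroup E] [ConditionallyCompleteLattice E] [IsOrderedAddMonoid E]
  [Module ℝ E] [IsOrderedModule ℝ E]

/-- The excess of a multiple of `v` over `x ≥ 0` lies in the band of `v`, so the local inequalities
are global and the Archimedean property applies. -/
theorem eq_zero_of_forall_locLE {v x : E} (hv : 0 ≤ v) (hx : 0 ≤ x) {c : ℝ} (hc : 0 < c)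
    (h : ∀ k : ℕ, LocLE v ((k : ℝ) • c • v) x) : v = 0 := by
  have hcv : 0 ≤ c • v := smul_nonneg hc.le hv
  have h1 : ∀ k : ℕ, (k : ℝ) • c • v ≤ x := fun k => by
    have hk : 0 ≤ (k : ℝ) • c • v := smul_nonneg k.cast_nonneg hcv
    have hle : ((k : ℝ) • c • v - x)⁺ ≤ (k : ℝ) • c • v := sup_le (sub_le_self _ hx) hk
    have h0 := smul_inf_eq_zero hv (posPart_nonneg ((k : ℝ) • c • v - x))
      (mul_nonneg k.cast_nonneg hc.le) ((inf_comm _ _).trans (h k))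
    rw [mul_smul, inf_eq_right.mpr hle] at h0
    exact sub_nonpos.mp (posPart_eq_zero.mp h0)
  have h2 := nonpos_of_forall_natCast_smul_le h1
  refine le_antisymm ?_ hv
  have := smul_le_smul_of_nonneg_left h2 (inv_nonneg.mpr hc.le)
  rwa [inv_smul_smul₀ hc.ne', smul_zero] at this

theorem isGLB_range_inv_smul {z : E} (hz : 0 ≤ z) :
    IsGLB (range fun n : ℕ => ((n : ℝ) + 1)⁻¹ • z) 0 := by
  refine ⟨?_, fun w hw => ?_⟩
  · rintro _ ⟨n, rfl⟩
    exact smul_nonneg (by positivity) hz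
  · have h1 : ∀ k : ℕ, (k : ℝ) • w ≤ z := fun k => by
      rcases k with _ | k
      · simpa using hz
      · have hk : (0 : ℝ) < (k : ℝ) + 1 := by positivity
        have := hw (mem_range_self k)
        push_cast
        rwa [le_inv_smul_iff_of_pos hk] at this
    exact nonpos_of_forall_natCast_smul_le h1

/-- If the inequality fails, its excess `w` is nonzero. On a small nonzero `v ≤ w`, `x` is within `ε
• s` of a multiple of `s`; since `|T s| ≤ c • s` there, `|T x| - c • x` is at most `ε • M ≤ (1 / 2)
• w`, although it dominates `w`. -/
theorem IsOrthomorphism.posPart_inf_le_of_nonneg {T : E →ₗ[ℝ] E} (hT : IsOrthomorphism T)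
    {x s : E} (hx : 0 ≤ x) (hs : 0 ≤ s) {c : ℝ} (hc : 0 < c) :
    (|T x| - c • x)⁺ ⊓ s ≤ c⁻¹ • |T s| := by
  set p := |T x| - c • x with hp
  set t := c⁻¹ • |T s| with ht
  have ht0 : 0 ≤ t := smul_nonneg (inv_nonneg.mpr hc.le) (abs_nonneg _)
  set w := (p⁺ ⊓ s - t)⁺ with hw
  have hw0 : 0 ≤ w := posPart_nonneg _
  have hwps : w ≤ p⁺ ⊓ s := sup_le (sub_le_self _ ht0) (le_inf (posPart_nonneg _) hs)
  suffices hw_eq : w = 0 from sub_nonpos.mp (posPart_eq_zero.mp hw_eq)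
  -- on the band of `w`, both `w ≤ p` and `|T s| ≤ c • s`
  have hwp : LocLE w w p := by
    refine inf_eq_zero_of_le (posPart_nonneg _) hw0 ?_ (hwps.trans inf_le_left)
      ((inf_comm _ _).trans (posPart_inf_negPart_eq_zero p))
    refine sup_le (sub_le_iff_le_add.mpr ?_) (negPart_nonneg _)
    have : p⁻ + p = p⁺ := by nth_rewrite 2 [← posPart_sub_negPart p]; abel
    rw [this]
    exact hwps.trans inf_le_left
  have hts : LocLE w |T s| (c • s) := by
    have h1 : LocLE w t s := by
      refine inf_eq_zero_of_le (posPart_nonneg _) hw0 ?_ le_rfl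
        ((inf_comm _ _).trans (posPart_inf_posPart_neg_eq_zero (p⁺ ⊓ s - t)))
      refine posPart_mono ?_
      rw [neg_sub]
      exact sub_le_sub_left inf_le_right t
    have h2 := h1.smul hw0 hc.le
    rwa [ht, smul_inv_smul₀ hc.ne'] at h2
  obtain ⟨M, hM0, hM⟩ := hT.orderBounded.exists_bound s
  by_contra hne
  obtain ⟨K, hK⟩ : ∃ K : ℕ, ¬ LocLE w ((K : ℝ) • (1 : ℝ) • w) M := by
    by_contra! h
    exact hne (eq_zero_of_forall_locLE hw0 hM0 one_pos h)
  -- A nonzero piece of `w` on whose band `M ≤ K • w`.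
  set v₁ := ((K : ℝ) • w - M)⁺ ⊓ w with hv₁
  have hv₁0 : 0 ≤ v₁ := le_inf (posPart_nonneg _) hw0
  have hv₁ne : v₁ ≠ 0 := by rwa [LocLE, one_smul] at hK
  have hMK : LocLE v₁ M ((K : ℝ) • w) := by
    refine inf_eq_zero_of_le (posPart_nonneg _) hv₁0 le_rfl inf_le_left ?_
    rw [← neg_sub M]
    exact posPart_inf_posPart_neg_eq_zero _
  -- This gives `ε * K ≤ 1 / 2`; the `+ 1` covers `K = 0`.
  set ε : ℝ := (2 * ((K : ℝ) + 1))⁻¹ with hε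
  have hε0 : 0 < ε := by positivity
  have hex : ∃ j : ℕ, ¬ LocLE v₁ ((j : ℝ) • ε • s) x := by
    by_contra! h
    refine hv₁ne (eq_zero_of_forall_locLE hv₁0 hx hε0 fun k => (h k).of_sub_le hv₁0 ?_)
    refine sub_le_sub_right (smul_le_smul_of_nonneg_left
      (smul_le_smul_of_nonneg_left ?_ hε0.le) k.cast_nonneg) x
    exact inf_le_right.trans (hwps.trans inf_le_right)
  classical
  -- The last grid level that stays below `x` on the whole band of `v₁`; level zero does because `0
  -- ≤ x`.
  obtain ⟨j, hj, hj'⟩ : ∃ j : ℕ, LocLE v₁ ((j : ℝ) • ε • s) x ∧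
      ¬ LocLE v₁ (((j : ℝ) + 1) • ε • s) x := by
    obtain ⟨m, hm⟩ : ∃ m, Nat.find hex = m + 1 := by
      refine Nat.exists_eq_succ_of_ne_zero fun h => ?_
      have := Nat.find_spec hex
      rw [h] at this
      exact this (.of_le hv₁0 (by simpa using hx))
    refine ⟨m, not_not.mp (Nat.find_min hex (by omega)), ?_⟩
    have := Nat.find_spec hex
    rw [hm] at this
    exact_mod_cast this
  -- On this band `x` lies between levels `j` and `j + 1`; `hj'` says that `v ≠ 0`.
  set v := (((j : ℝ) + 1) • ε • s - x)⁺ ⊓ v₁ with hv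
  have hv0 : 0 ≤ v := le_inf (posPart_nonneg _) hv₁0
  have hvv₁ : v ≤ v₁ := inf_le_right
  have hvw : v ≤ w := hvv₁.trans inf_le_right
  set r := x - (j : ℝ) • ε • s with hr
  have hr0 : LocLE v 0 r :=
    (hj.mono hv0 hvv₁).of_sub_le hv0 (by rw [hr]; exact (by abel : _ = _).le)
  have hr1 : LocLE v r (ε • s) := by
    have h1 : LocLE v x (((j : ℝ) + 1) • ε • s) := by
      refine inf_eq_zero_of_le (posPart_nonneg _) hv0 le_rfl inf_le_left ?_
      rw [← neg_sub x]
      exact posPart_inf_posPart_neg_eq_zero _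
    refine h1.of_sub_le hv0 ?_
    rw [hr, add_smul, one_smul]
    exact (by abel : _ = _).le
  have hTr : LocLE v |T r| (ε • M) := hT.locLE_abs hv0 hs hε0 (hM ε hε0) hr0 hr1
  have hjε : 0 ≤ (j : ℝ) * ε := by positivity
  have hTx : |T x| ≤ ((j : ℝ) * ε) • |T s| + |T r| := by
    have hxe : x = ((j : ℝ) * ε) • s + r := by rw [hr, mul_smul]; abel
    have h1 : T x = ((j : ℝ) * ε) • T s + T r := by rw [hxe, map_add, map_smul]
    rw [h1]
    refine (abs_add_le _ _).trans (add_le_add_left ?_ _)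
    simpa [abs_of_nonneg hjε] using abs_smul_le_smul_abs ((j : ℝ) * ε) (T s)
  have hjx : LocLE v (((j : ℝ) * ε) • |T s|) (c • x) := by
    have h1 := (hts.mono hv0 hvw).smul hv0 hjε
    have h2 := (hj.mono hv0 hvv₁).smul hv0 hc.le
    refine h1.trans hv0 ?_
    rwa [smul_comm, mul_smul]
  have hwM : LocLE v w (ε • M) := by
    refine ((hwp.mono hv0 hvw).add hv0 (hjx.add hv0 hTr)).of_sub_le hv0 ?_
    have h3 : p ≤ ((j : ℝ) * ε) • |T s| + |T r| - c • x := sub_le_sub_right hTx _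
    have h4 : w - ε • M = w + (((j : ℝ) * ε) • |T s| + |T r|) -
        ((((j : ℝ) * ε) • |T s| + |T r| - c • x) + (c • x + ε • M)) := by abel
    rw [h4]
    exact sub_le_sub_left (add_le_add_left h3 _) _
  have hww : LocLE v w ((ε * K) • w) := by
    have := hwM.trans hv0 ((hMK.mono hv0 hvv₁).smul hv0 hε0.le)
    rwa [← mul_smul] at this
  have hεK : ε * K ≤ 1 / 2 := by
    rw [hε, inv_mul_le_iff₀ (by positivity)]
    linarith
  have hwhalf : ((1 / 2 : ℝ) • w) ⊓ v = 0 := by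
    refine inf_eq_zero_of_le (smul_nonneg (by norm_num) hw0) hv0 (le_trans ?_ (le_posPart _))
      le_rfl hww
    have : (1 / 2 : ℝ) • w = w - (1 / 2 : ℝ) • w := by
      nth_rewrite 2 [← one_smul ℝ w]
      rw [← sub_smul]
      norm_num
    rw [this]
    exact sub_le_sub_left (smul_le_smul_of_nonneg_right hεK hw0) w
  -- Thus `w` is disjoint from `v`; as `v ≤ w`, this forces `v = 0`.
  have hwv := smul_inf_eq_zero (smul_nonneg (by norm_num) hw0) hv0 (c := 2) (by norm_num) hwhalf
  rw [smul_smul, show (2 : ℝ) * (1 / 2) = 1 by norm_num, one_smul, inf_eq_right.mpr hvw] at hwv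
  exact hj' hwv

/-- The factor 2 comes from treating `x⁺` and `x⁻` separately. -/
theorem IsOrthomorphism.posPart_inf_le {T : E →ₗ[ℝ] E} (hT : IsOrthomorphism T) (x : E)
    {s : E} (hs : 0 ≤ s) {c : ℝ} (hc : 0 < c) :
    (|T x| - c • |x|)⁺ ⊓ s ≤ c⁻¹ • ((2 : ℝ) • |T s|) := by
  have h1 := hT.posPart_inf_le_of_nonneg (posPart_nonneg x) hs hc
  have h2 := hT.posPart_inf_le_of_nonneg (negPart_nonneg x) hs hc
  have h3 : (|T x| - c • |x|)⁺ ≤ (|T x⁺| - c • x⁺)⁺ + (|T x⁻| - c • x⁻)⁺ := by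
    refine (posPart_mono ?_).trans (add_posPart_le _ _)
    rw [← posPart_add_negPart x, smul_add, sub_add_sub_comm]
    refine sub_le_sub_right ?_ _
    conv_lhs => rw [← posPart_sub_negPart x, map_sub, sub_eq_add_neg]
    simpa using abs_add_le (T x⁺) (-T x⁻)
  have h4 := abs_add_inf_le ((|T x⁺| - c • x⁺)⁺) ((|T x⁻| - c • x⁻)⁺) s
  rw [abs_of_nonneg hs, abs_of_nonneg (posPart_nonneg (|T x⁺| - c • x⁺)),
    abs_of_nonneg (posPart_nonneg (|T x⁻| - c • x⁻)),
    abs_of_nonneg (add_nonneg (posPart_nonneg _) (posPart_nonneg _))] at h4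
  rw [two_smul, smul_add]
  exact (inf_le_inf_right s h3).trans (h4.trans (add_le_add h1 h2))

/-! ### From the estimate to convergence. -/

/-- For a uo-Lebesgue topology, an orthomorphism is, up to any given neighbourhood of zero,
dominated by a multiple of the identity. -/
theorem IsOrthomorphism.exists_posPart_mem {T : E →ₗ[ℝ] E} (hT : IsOrthomorphism T)
    {τ : TopologicalSpace E} (hτ : IsUoLebesgueTopology τ) {V : Set E} (hV : V ∈ @nhds E τ 0) :
    ∃ c : ℝ, ∀ x, (|T x| - c • |x|)⁺ ∈ V := by
  by_contra! h
  choose y hy using h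
  -- Counterexamples for `c = n + 1` form a uo-null sequence outside `V`; the lift puts the index
  -- set in the universe of `E`.
  let z : ULift.{u} ℕ → E := fun n =>
    (|T (y (n.down + 1))| - ((n.down : ℝ) + 1) • |y (n.down + 1)|)⁺
  have hdir : IsDirectedOrder (ULift.{u} ℕ) :=
    ⟨fun a b => ⟨⟨max a.down b.down⟩, le_max_left a.down b.down, le_max_right a.down b.down⟩⟩
  have huo : UnboundedOrderConverges z 0 := fun s hs => by
    have hs2 : 0 ≤ (2 : ℝ) • |T s| := smul_nonneg (by norm_num) (abs_nonneg _)
    have hanti : Antitone fun n : ULift.{u} ℕ => ((n.down : ℝ) + 1)⁻¹ • ((2 : ℝ) • |T s|) := by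
      intro m n hmn
      refine smul_le_smul_of_nonneg_right (inv_anti₀ (by positivity) ?_) hs2
      have : m.down ≤ n.down := hmn
      gcongr
    refine ⟨ULift.{u} ℕ, inferInstance, hdir, inferInstance,
      fun n => ((n.down : ℝ) + 1)⁻¹ • ((2 : ℝ) • |T s|), hanti, ?_, fun m => ⟨m, fun n hn => ?_⟩⟩
    · convert isGLB_range_inv_smul hs2 using 1
      exact ULift.down_surjective.range_comp fun n : ℕ => ((n : ℝ) + 1)⁻¹ • ((2 : ℝ) • |T s|)
    · have h0 : 0 ≤ z n := posPart_nonneg _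
      simp only [sub_zero, zero_sub, abs_neg]
      rw [abs_of_nonneg h0, abs_of_nonneg (le_inf h0 hs)]
      exact (hT.posPart_inf_le _ hs (by positivity)).trans (hanti hn)
  obtain ⟨n, hn⟩ := mem_atTop_sets.mp (hτ.tendsto_of_uo _ z huo hV)
  exact hy _ (hn n le_rfl)

end DedekindComplete

/-- Orthomorphisms of a Dedekind complete vector lattice `E` preserve convergence to zero in a
Hausdorff uo-Lebesgue topology, and turn convergence to zero in a locally solid linear topology
into convergence to zero in the unbounded topology generated by it. -/
theorem mainTheorem9 {E : Type u} [AddCommGroup E] [ConditionallyCompleteLattice E]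
    [IsOrderedAddMonoid E] [Module ℝ E] [IsOrderedModule ℝ E]
    (T : E →ₗ[ℝ] E) (hT : IsOrthomorphism T)
    {ι : Type v} [Preorder ι] [IsDirectedOrder ι] [Nonempty ι] (x : ι → E) :
    (∀ τ : TopologicalSpace E, IsUoLebesgueTopology τ → @T2Space E τ →
      Tendsto x atTop (@nhds E τ 0) →
        Tendsto (fun i => T (x i)) atTop (@nhds E τ 0)) ∧
    (∀ τ : TopologicalSpace E, IsLocallySolidLinearTopology τ →
      Tendsto x atTop (@nhds E τ 0) →
        Tendsto (fun i => T (x i)) atTop (@nhds E (unboundedTopology τ) 0)) := by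
  refine ⟨fun τ hτ _ hx => ?_, fun τ hτ hx => ?_⟩
  · refine hτ.locallySolid.tendsto_zero_of_abs_le hx fun V hV => ?_
    obtain ⟨c, hc⟩ := hT.exists_posPart_mem hτ hV
    exact ⟨c, fun i => (|T (x i)| - c • |x i|)⁺, fun i => hc (x i),
      fun i => le_add_posPart_sub _ _⟩
  · refine (tendsto_unboundedTopology_zero hτ).mpr fun s => ?_
    refine hτ.tendsto_zero_of_abs_le hx fun V hV => ?_
    obtain ⟨n, hn⟩ : ∃ n : ℕ, ((n : ℝ) + 1)⁻¹ • ((2 : ℝ) • |T (|s|)|) ∈ V := by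
      have := hτ.continuousSMul
      have h1 : Tendsto (fun n : ℕ => ((n : ℝ) + 1)⁻¹ • ((2 : ℝ) • |T (|s|)|)) atTop (nhds 0) := by
        have h2 : Tendsto (fun n : ℕ => ((n : ℝ) + 1)⁻¹) atTop (nhds 0) := by
          simpa using tendsto_one_div_add_atTop_nhds_zero_nat (𝕜 := ℝ)
        simpa using h2.smul_const ((2 : ℝ) • |T (|s|)|)
      exact (h1.eventually hV).exists
    -- The error is the constant `2 / c • |T |s||` with `c = n + 1`, whatever the index.
    refine ⟨(n : ℝ) + 1, fun _ => _, fun _ => hn, fun i => ?_⟩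
    have hn0 : (0 : ℝ) < (n : ℝ) + 1 := by positivity
    have hcx : 0 ≤ ((n : ℝ) + 1) • |x i| := smul_nonneg hn0.le (abs_nonneg _)
    rw [abs_of_nonneg (le_inf (abs_nonneg _) (abs_nonneg _))]
    refine le_trans ?_ (add_le_add_right (hT.posPart_inf_le (x i) (abs_nonneg s) hn0) _)
    -- Translation by `c • |x i|` distributes over the infimum, leaving two separate bounds.
    rw [add_inf]
    exact inf_le_inf (le_add_posPart_sub _ _) (le_add_of_nonneg_left hcx)
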